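/- Let $\Omega$ be a closed disk of unit radius in the Euclidean plane. For $n \ge 3$ and points $A_1,\dots,A_n$ in the plane, let $\mathrm{per}(A_1A_2\cdots A_n)=\sum_{i=1}^n |A_iA_{i+1}|$ (with $A_{n+1}=A_1$) be the perimeter of the closed polygonal chain $A_1A_2\cdots A_n$. The chain is called simple if its vertices are pairwise distinct, any two consecutive sides meet only in their common vertex, and any two non-consecutive sides are disjoint. Let $$F(n)=\sup\{\mathrm{per}(A_1A_2\cdots A_n) : A_1,\dots,A_n\in\Omega,\ A_1A_2\cdots A_n \text{ simple}\}.$$ Then for every odd integer $n\ge 3$, $$F(n)=\frac{\sqrt{8(n-2)^2-2+2\sqrt{1+8(n-2)^2}}\cdot\left(\sqrt{1+8(n-2)^2}+3\right)}{4(n-2)}.$$ -/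

import Mathlib

/-- The perimeter of the closed polygonal chain `A₁ A₂ … Aₙ`: the sum of the lengths of its `n`
sides `Aᵢ Aᵢ₊₁`, indices being cyclic. -/
noncomputable def Polygon.perimeter {n : ℕ} (A : Polygon (EuclideanSpace ℝ (Fin 2)) n) : ℝ :=
  ∑ i, dist (A i) (A (finRotate n i))

/-- The closed polygonal chain `A₁ A₂ … Aₙ` (for `n ≥ 3`) is simple: its vertices are pairwise
distinct, two consecutive sides meet only in their common vertex, and two sides that are not
consecutive are disjoint. -/
def Polygon.IsSimple {n : ℕ} (A : Polygon (EuclideanSpace ℝ (Fin 2)) n) : Prop :=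
  Function.Injective A.vertices ∧
  (∀ i, A.edgeSet ℝ i ∩ A.edgeSet ℝ (finRotate n i) = {A (finRotate n i)}) ∧
  ∀ i j, i ≠ j → j ≠ finRotate n i → i ≠ finRotate n j →
    Disjoint (A.edgeSet ℝ i) (A.edgeSet ℝ j)

/-- The set of the perimeters of all simple `n`-gons whose vertices lie in the closed disk of
unit radius with centre `o`. -/
def simplePerimeters (o : EuclideanSpace ℝ (Fin 2)) (n : ℕ) : Set ℝ :=
  {p | ∃ A : Polygon (EuclideanSpace ℝ (Fin 2)) n,
    (∀ i, A i ∈ Metric.closedBall o 1) ∧ A.IsSimple ∧ A.perimeter = p}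

/-!
Let `m = n - 2`. The bound is the maximum over `s ∈ [0, 1]` of `m · 2b + √(8 + 8s)`, where
`b = √(1 - s²)` (`length_le_value`, `value_eq`): the chord at distance `s` from the centre has
length `2b`, and `√(8 + 8s)` is the sum of the legs of the inscribed isosceles triangle over it
whose apex is on the far side of the centre.

*Upper bound.* Let `2b` be the length of the longest side `XY`, and `s = √(1 - b²)`. If
`2b ≤ √3`, then the perimeter is at most `n √3`, which is the value for `s = 1 / 2`. Otherwise
`s < 1 / 2`, and it suffices to find two sides of total length at most `√(8 + 8s)`
(`exists_two_sides`), since the other `n - 2` sides are at most `2b` long. Take coordinates centred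
in the disk in which `XY` is horizontal; `XY` then lies in the strip `|y| ≤ s`, whose bounding
chords have length `2b`.

* If some side crosses the strip from one outer region to the other, it does so without meeting
  `XY`, because the polygon is simple. As `XY` is as long as the bounding chords, this leaves only a
  narrow gap next to the circle, so that this side is at most `4sb` long
  (`sq_dist_le_of_cross_strip`). Together with any further side, this is at most
  `2b (1 + 2s) ≤ √(8 + 8s)`.
* If no side crosses the strip, use that `n` is odd: some side `UV` has both ends on the same side of
  the vertical axis. Let `V` be its end nearer to the axis and `VW` the other side at `V`. Then
  `|UV|² + |VW|² ≤ 4 + 4s`. This holds for all `U` and `W` if `V` lies in the strip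
  (`sq_add_sq_le_of_mem_strip`), and if `V` lies above the strip it holds because `U` and `W` do
  not lie below it (`sq_add_sq_le_of_height`).

*Lower bound.* A chain of decreasing heights is simple when closed by a side that has all other
vertices strictly on one side (`isSimple_of_strictAnti`). Such chains approximate the path that
starts at the apex of an inscribed isosceles triangle, runs along the left leg, then `m` times
along the base, and returns along the right leg (`zigzag`). Their perimeters tend to the length of
this path (`le_of_mem_upperBounds`), and the optimal triangle gives the bound.
-/

/-! ### Inequalities for points of the unit disk -/

/-- Two sides `UV`, `VW` in the unit disk, where `V` lies in the strip `|y| ≤ s` and `U` lies further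
out than `V` on the same side of the vertical axis. -/
lemma sq_add_sq_le_of_mem_strip {s u1 u2 v1 v2 w1 w2 : ℝ} (hs : s ≤ 1 / 2)
    (hU : u1 ^ 2 + u2 ^ 2 ≤ 1) (hV : v1 ^ 2 + v2 ^ 2 ≤ 1) (hW : w1 ^ 2 + w2 ^ 2 ≤ 1)
    (hv1 : 0 ≤ v1) (huv : v1 ≤ u1) (hv2 : |v2| ≤ s) :
    (u1 - v1) ^ 2 + (u2 - v2) ^ 2 + ((v1 - w1) ^ 2 + (v2 - w2) ^ 2) ≤ 4 + 4 * s := by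
  have h1 : -(u2 * v2) ≤ |v2| := by
    have hu2 : |u2| ≤ 1 := abs_le_one_iff_mul_self_le_one.2 (by nlinarith [sq_nonneg u1])
    calc -(u2 * v2) ≤ |u2 * v2| := neg_le_abs _
      _ = |u2| * |v2| := abs_mul _ _
      _ ≤ |v2| := mul_le_of_le_one_left (abs_nonneg _) hu2
  have h2 : v1 * v1 ≤ u1 * v1 := mul_le_mul_of_nonneg_right huv hv1
  have h3 : v2 ^ 2 ≤ s / 2 := by
    rw [← sq_abs]; nlinarith [abs_nonneg v2]
  nlinarith [sq_nonneg (v1 + w1), sq_nonneg (v2 + w2), hV]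

/-- From a point `V` of the disk above the height `s`, the farthest point of the part `y ≥ -s` of
the disk is an end `(-b, -s)` of the chord bounding it. -/
lemma inner_le_of_height {s b v1 v2 w1 w2 : ℝ} (hs : 0 ≤ s) (hb : 0 < b) (hsb : b ^ 2 + s ^ 2 = 1)
    (hV : v1 ^ 2 + v2 ^ 2 ≤ 1) (hW : w1 ^ 2 + w2 ^ 2 ≤ 1) (hv1 : 0 ≤ v1) (hv2 : s ≤ v2)
    (hw2 : -s ≤ w2) : -(v1 * w1 + v2 * w2) ≤ v1 * b + v2 * s := by
  by_cases hw1 : -w1 ≤ b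
  · nlinarith [mul_nonneg hv1 (sub_nonneg.2 hw1), mul_nonneg (hs.trans hv2) (by linarith : 0 ≤ s + w2)]
  · push Not at hw1
    -- `V` is steeper than the direction `(b, s)` because it lies higher
    have hvb : v1 ≤ b := abs_le_of_sq_le_sq' (by nlinarith) hb.le |>.2
    have hst : s * v1 ≤ v2 * b := by nlinarith
    have h1 : b * (-w1 - b) ≤ s * (s + w2) := by nlinarith [sq_nonneg (-w1 - b), sq_nonneg (s + w2)]
    have h2 : b * (v1 * (-w1 - b)) ≤ b * (v2 * (s + w2)) := by
      nlinarith [mul_le_mul_of_nonneg_left h1 hv1,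
        mul_le_mul_of_nonneg_right hst (by linarith : 0 ≤ s + w2)]
    have := le_of_mul_le_mul_left h2 hb
    nlinarith

/-- Two sides `UV`, `VW` in the part `y ≥ -s` of the unit disk, where `V` lies above the height `s`
and `U` lies further out than `V` on the same side of the vertical axis. -/
lemma sq_add_sq_le_of_height {s u1 u2 v1 v2 w1 w2 : ℝ} (hs0 : 0 ≤ s) (hs : s ≤ 1 / 2)
    (hU : u1 ^ 2 + u2 ^ 2 ≤ 1) (hV : v1 ^ 2 + v2 ^ 2 ≤ 1) (hW : w1 ^ 2 + w2 ^ 2 ≤ 1)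
    (hv1 : 0 ≤ v1) (huv : v1 ≤ u1) (hv2 : s ≤ v2) (hu2 : -s ≤ u2) (hw2 : -s ≤ w2) :
    (u1 - v1) ^ 2 + (u2 - v2) ^ 2 + ((v1 - w1) ^ 2 + (v2 - w2) ^ 2) ≤ 4 + 4 * s := by
  set b := √(1 - s ^ 2) with hbdef
  have hb : 0 < b := Real.sqrt_pos.2 (by nlinarith)
  have hsb : b ^ 2 + s ^ 2 = 1 := by rw [Real.sq_sqrt (by nlinarith)]; ring
  have hv20 : 0 ≤ v2 := hs0.trans hv2
  have hv2' : v2 ≤ 1 := by nlinarith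
  have hVW : (v1 - w1) ^ 2 + (v2 - w2) ^ 2 ≤ v1 ^ 2 + v2 ^ 2 + 1 + 2 * (v1 * b + v2 * s) := by
    nlinarith [inner_le_of_height hs0 hb hsb hV hW hv1 hv2 hw2]
  have hs2 : s * v2 ≤ s := mul_le_of_le_one_right hs0 hv2'
  by_cases hu1 : b ≤ u1
  · nlinarith [mul_le_mul_of_nonneg_left hu1 hv1, mul_nonneg hv20 (by linarith : 0 ≤ u2 + s)]
  push Not at hu1
  by_cases huv2 : u2 ≤ v2
  · have h1 : (u1 - v1) ^ 2 ≤ (b - v1) ^ 2 := pow_le_pow_left₀ (by linarith) (by linarith) 2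
    have h2 : (u2 - v2) ^ 2 ≤ (s + v2) ^ 2 := by
      rw [← neg_sq]; exact pow_le_pow_left₀ (by linarith) (by linarith) 2
    nlinarith
  · push Not at huv2
    have h1 : v1 * v1 ≤ u1 * v1 := mul_le_mul_of_nonneg_right huv hv1
    have h2 : v2 * v2 ≤ u2 * v2 := mul_le_mul_of_nonneg_right huv2.le hv20
    nlinarith [sq_nonneg (v1 - b)]

/-- The segment with end heights `p` and `q` passes through the strip `|y| ≤ s`, leaving it on
both sides. -/
def IsSteep (s p q : ℝ) : Prop := (s < p ∧ q < -s) ∨ (p < -s ∧ s < q)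

lemma IsSteep.symm {s p q : ℝ} (h : IsSteep s p q) : IsSteep s q p :=
  h.elim (fun h => Or.inr h.symm) fun h => Or.inl h.symm

/-- Of two consecutive sides `UV`, `VW` in the unit disk, of which `UV` does not meet the vertical
axis and `V` is its end nearer to this axis, either one crosses the strip `|y| ≤ s`, or they are
together no longer than the two legs of an isosceles triangle inscribed in the disk with a base at
distance `s` from the centre. -/
lemma isSteep_or_sq_add_sq_le {s u1 u2 v1 v2 w1 w2 : ℝ} (hs0 : 0 ≤ s) (hs : s ≤ 1 / 2)
    (hU : u1 ^ 2 + u2 ^ 2 ≤ 1) (hV : v1 ^ 2 + v2 ^ 2 ≤ 1) (hW : w1 ^ 2 + w2 ^ 2 ≤ 1)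
    (huv0 : 0 ≤ u1 * v1) (huv : |v1| ≤ |u1|) :
    IsSteep s u2 v2 ∨ IsSteep s v2 w2 ∨
    (u1 - v1) ^ 2 + (u2 - v2) ^ 2 + ((v1 - w1) ^ 2 + (v2 - w2) ^ 2) ≤ 4 + 4 * s := by
  -- reflections bring `U` and `V` to the right half-plane, and `V` to the upper one
  wlog hu1 : 0 ≤ u1 generalizing u1 v1 w1
  · have := this (u1 := -u1) (v1 := -v1) (w1 := -w1) (by simpa using hU) (by simpa using hV)
      (by simpa using hW) (by simpa using huv0) (by simpa using huv) (by linarith)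
    refine this.imp id (Or.imp id fun h => ?_)
    linarith
  wlog hv2 : 0 ≤ v2 generalizing u2 v2 w2
  · have := this (u2 := -u2) (v2 := -v2) (w2 := -w2) (by simpa using hU) (by simpa using hV)
      (by simpa using hW) (by linarith)
    rcases this with (h | h) | (h | h) | h
    · exact Or.inl (Or.inr ⟨by linarith, by linarith⟩)
    · exact Or.inl (Or.inl ⟨by linarith, by linarith⟩)
    · exact Or.inr (Or.inl (Or.inr ⟨by linarith, by linarith⟩))
    · exact Or.inr (Or.inl (Or.inl ⟨by linarith, by linarith⟩))
    · exact Or.inr (Or.inr (by linarith))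
  rw [abs_of_nonneg hu1] at huv
  have huv' : v1 ≤ u1 := (le_abs_self _).trans huv
  have hv1 : 0 ≤ v1 := by
    rcases hu1.eq_or_lt with h | h
    · rw [← h] at huv
      exact (abs_eq_zero.1 (huv.antisymm (abs_nonneg _))).ge
    · exact nonneg_of_mul_nonneg_right huv0 h
  by_cases hst : |v2| ≤ s
  · exact Or.inr (Or.inr (sq_add_sq_le_of_mem_strip hs hU hV hW hv1 huv' hst))
  rw [abs_of_nonneg hv2] at hst
  push Not at hst
  by_cases hu2 : -s ≤ u2
  · by_cases hw2 : -s ≤ w2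
    · exact Or.inr (Or.inr (sq_add_sq_le_of_height hs0 hs hU hV hW hv1 huv' hst.le hu2 hw2))
    · exact Or.inr (Or.inl (Or.inl ⟨hst, not_le.1 hw2⟩))
  · exact Or.inl (Or.inr ⟨not_le.1 hu2, hst⟩)

/-- A line `x = x₀ + μ y` that crosses the strip `|y| ≤ s` inside the unit disk, and passes aside
of a horizontal segment `XY` of the disk as long as the chords bounding the strip, is steep and
far from the centre. -/
lemma offset_and_slope_bounds {s b h x y x₀ μ : ℝ} (hb : 0 < b) (hsb : b ^ 2 + s ^ 2 = 1)
    (hX : x ^ 2 + h ^ 2 ≤ 1) (hY : y ^ 2 + h ^ 2 ≤ 1) (hxy : y - x = 2 * b)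
    (hs1 : (x₀ + μ * s) ^ 2 + s ^ 2 ≤ 1) (hs2 : (x₀ - μ * s) ^ 2 + s ^ 2 ≤ 1)
    (hh : h ∈ Set.Icc (-s) s) (hout : x₀ + μ * h ∉ Set.Icc x y) :
    1 - 2 * s ^ 2 ≤ b * |x₀| ∧ b * |μ| ≤ s := by
  obtain ⟨hh1, hh2⟩ := hh
  have hs0 : 0 ≤ s := by linarith
  wlog hleft : x₀ + μ * h < x generalizing x y x₀ μ
  · have hright : y < x₀ + μ * h := by
      by_contra hc
      exact hout ⟨not_lt.1 hleft, not_lt.1 hc⟩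
    have := this (x := -y) (y := -x) (x₀ := -x₀) (μ := -μ) (by simpa using hY) (by simpa using hX)
      (by linarith) (by linarith) (by linarith)
      (fun hc => hleft (by linarith [hc.1, hc.2])) (by linarith)
    simpa using this
  have hA : 0 ≤ b + (x₀ + μ * s) := by
    linarith [(abs_le_of_sq_le_sq' (a := x₀ + μ * s) (b := b) (by linarith) hb.le).1]
  have hB : 0 ≤ b + (x₀ - μ * s) := by
    linarith [(abs_le_of_sq_le_sq' (a := x₀ - μ * s) (b := b) (by linarith) hb.le).1]
  set A := b + (x₀ + μ * s) with hAdef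
  set B := b + (x₀ - μ * s) with hBdef
  -- the overhang `y - b` of the chord at height `h` over those bounding the strip
  have hover : 2 * b * (y - b) ≤ s ^ 2 - h ^ 2 := by nlinarith [sq_nonneg (y - b)]
  have hlt : x₀ + μ * h + b < y - b := by linarith
  have hcomb : b * ((s + h) * A + (s - h) * B) ≤ s * (s ^ 2 - h ^ 2) := by
    have : (s + h) * A + (s - h) * B = 2 * s * (x₀ + μ * h + b) := by rw [hAdef, hBdef]; ring
    rw [this]
    linarith [mul_le_mul_of_nonneg_left hover hs0, mul_nonneg (mul_nonneg hs0 hb.le) (sub_nonneg.2 hlt.le)]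
  have hlt1 : 0 < s + h := by
    by_contra hc
    have h0 : h = -s := by linarith
    subst h0
    nlinarith
  have hlt2 : 0 < s - h := by
    by_contra hc
    have h0 : h = s := by linarith
    subst h0
    nlinarith
  have hsum : b * (A + B) ≤ 2 * s ^ 2 := by
    -- weigh `A` by `s + h` and `B` by `s - h`; both weights are at most `2 s`
    have h1 : (s + h) * (s - h) * (b * (A + B)) ≤ (s + h) * (s - h) * (2 * s ^ 2) := by
      have e1 : (s + h) * (s - h) * (b * A) ≤ (2 * s) * ((s + h) * (b * A)) := by
        have : 0 ≤ (s + h) * (b * A) := by positivity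
        nlinarith
      have e2 : (s + h) * (s - h) * (b * B) ≤ (2 * s) * ((s - h) * (b * B)) := by
        have : 0 ≤ (s - h) * (b * B) := by positivity
        nlinarith
      linarith [mul_le_mul_of_nonneg_left hcomb hs0]
    exact le_of_mul_le_mul_left h1 (by positivity)
  have hs_pos : 0 < s := by linarith
  constructor
  · have : -x₀ ≤ |x₀| := neg_le_abs _
    nlinarith [mul_le_mul_of_nonneg_left this hb.le]
  · have : s * |μ| ≤ (A + B) / 2 := by
      rw [show s * |μ| = |s * μ| by rw [abs_mul, abs_of_pos hs_pos]]
      exact abs_le.2 ⟨by linarith, by linarith⟩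
    have h3 : s * (b * |μ|) ≤ s * s := by nlinarith [mul_le_mul_of_nonneg_left this hb.le]
    exact le_of_mul_le_mul_left h3 hs_pos

/-- The length of a chord of the unit disk is bounded through the distance of its line
`x = x₀ + μ y` from the centre. -/
lemma sq_dist_le_of_offset_and_slope {s b x₀ μ p1 p2 q1 q2 : ℝ} (hs0 : 0 ≤ s) (hs : s ≤ 1 / 2)
    (hb : 0 < b) (hsb : b ^ 2 + s ^ 2 = 1) (hP : p1 ^ 2 + p2 ^ 2 ≤ 1) (hQ : q1 ^ 2 + q2 ^ 2 ≤ 1)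
    (hp : p1 = x₀ + μ * p2) (hq : q1 = x₀ + μ * q2) (hx₀ : 1 - 2 * s ^ 2 ≤ b * |x₀|)
    (hμ : b * |μ| ≤ s) : (p1 - q1) ^ 2 + (p2 - q2) ^ 2 ≤ (4 * s * b) ^ 2 := by
  have k0 : 0 ≤ 1 - 2 * s ^ 2 := by nlinarith
  have k1 : (1 - 2 * s ^ 2) ^ 2 ≤ b ^ 2 * x₀ ^ 2 := by
    rw [← sq_abs x₀, ← mul_pow]; exact pow_le_pow_left₀ k0 hx₀ 2
  have k2 : b ^ 2 * μ ^ 2 ≤ s ^ 2 := by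
    rw [← sq_abs μ, ← mul_pow]; exact pow_le_pow_left₀ (by positivity) hμ 2
  -- the squared distance of the midpoint from the centre
  obtain ⟨M, hM⟩ : ∃ M, M = ((p1 + q1) / 2) ^ 2 + ((p2 + q2) / 2) ^ 2 := ⟨_, rfl⟩
  have hM0 : 0 ≤ M := by rw [hM]; positivity
  have hCS : x₀ ^ 2 ≤ M * (1 + μ ^ 2) := by
    have : x₀ = (p1 + q1) / 2 - μ * ((p2 + q2) / 2) := by rw [hp, hq]; ring
    rw [this, hM]
    linarith [sq_nonneg (μ * ((p1 + q1) / 2) + (p2 + q2) / 2)]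
  have hM1 : (1 - 2 * s ^ 2) ^ 2 ≤ M := by
    have h1 := mul_le_mul_of_nonneg_left hCS (sq_nonneg b)
    have h2 := mul_le_mul_of_nonneg_left k2 hM0
    have h3 : M * (b ^ 2 + s ^ 2) = M := by rw [hsb, mul_one]
    linarith
  have h4 : (4 * s * b) ^ 2 = 4 - 4 * (1 - 2 * s ^ 2) ^ 2 := by
    rw [mul_pow, show b ^ 2 = 1 - s ^ 2 by linarith]; ring
  rw [h4]
  linarith

/-- A segment `PQ` of the unit disk that passes through the strip `|y| ≤ s` and avoids a horizontal
segment `XY` of the disk, of the length `2 b` of the chords bounding the strip, has length at most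
`4 s b`: it is squeezed between an end of `XY` and the circle. -/
lemma sq_dist_le_of_cross_strip {s b h x y p1 p2 q1 q2 : ℝ} (hs0 : 0 ≤ s) (hs : s ≤ 1 / 2)
    (hb : 0 < b) (hsb : b ^ 2 + s ^ 2 = 1) (hX : x ^ 2 + h ^ 2 ≤ 1) (hY : y ^ 2 + h ^ 2 ≤ 1)
    (hxy : y - x = 2 * b) (hP : p1 ^ 2 + p2 ^ 2 ≤ 1) (hQ : q1 ^ 2 + q2 ^ 2 ≤ 1)
    (hp2 : s < p2) (hq2 : q2 < -s)
    (hdisj : ∀ t, 0 ≤ t → t ≤ 1 → p2 + t * (q2 - p2) = h → p1 + t * (q1 - p1) ∉ Set.Icc x y) :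
    (p1 - q1) ^ 2 + (p2 - q2) ^ 2 ≤ (4 * s * b) ^ 2 := by
  have hD : 0 < p2 - q2 := by linarith
  have hh : h ^ 2 ≤ s ^ 2 := by nlinarith [sq_nonneg (x + y)]
  obtain ⟨hh1, hh2⟩ := abs_le_of_sq_le_sq' hh hs0
  -- the line `PQ` is `x = x₀ + μ y`
  obtain ⟨μ, hμ⟩ : ∃ μ, q1 - p1 = μ * (q2 - p2) := ⟨(q1 - p1) / (q2 - p2), by
    rw [div_mul_cancel₀ _ (by linarith)]⟩
  obtain ⟨x₀, hx₀⟩ : ∃ x₀, p1 = x₀ + μ * p2 := ⟨p1 - μ * p2, by ring⟩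
  have hq1 : q1 = x₀ + μ * q2 := by linarith
  -- at the heights inside the strip, the line is inside the disk and has the segment `XY` aside
  have hseg : ∀ z, -s ≤ z → z ≤ s → (x₀ + μ * z) ^ 2 + z ^ 2 ≤ 1 := by
    intro z hz1 hz2
    subst hx₀ hq1
    have hconv : ((p2 - z) * ((x₀ + μ * q2) ^ 2 + q2 ^ 2) + (z - q2) * ((x₀ + μ * p2) ^ 2 + p2 ^ 2))
      - (p2 - q2) * ((x₀ + μ * z) ^ 2 + z ^ 2) = (1 + μ ^ 2) * ((p2 - q2) * (p2 - z) * (z - q2)) := by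
      ring
    have h1 : 0 ≤ p2 - z := by linarith
    have h2 : 0 ≤ z - q2 := by linarith
    have h3 : 0 ≤ (1 + μ ^ 2) * ((p2 - q2) * (p2 - z) * (z - q2)) := by positivity
    refine le_of_mul_le_mul_left ?_ hD
    linarith [mul_le_mul_of_nonneg_left hP h2, mul_le_mul_of_nonneg_left hQ h1]
  have hout : x₀ + μ * h ∉ Set.Icc x y := by
    have := hdisj ((p2 - h) / (p2 - q2)) (div_nonneg (by linarith) hD.le)
      ((div_le_one hD).2 (by linarith)) (by field_simp; ring)
    have e : p1 + (p2 - h) / (p2 - q2) * (q1 - p1) = x₀ + μ * h := by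
      rw [hμ, hx₀]; field_simp; ring
    rwa [e] at this
  have hs1 := hseg s (by linarith) le_rfl
  have hs2 := hseg (-s) le_rfl (by linarith)
  obtain ⟨k1, k2⟩ := offset_and_slope_bounds hb hsb hX hY hxy hs1
    (by simpa [← sub_eq_add_neg] using hs2) ⟨hh1, hh2⟩ hout
  exact sq_dist_le_of_offset_and_slope hs0 hs hb hsb hP hQ hx₀ hq1 k1 k2

/-! ### The one-variable maximum -/

/-- The value `4 y (1 + m x)` at the critical point `x = (√(1 + 8 m²) - 1) / (4 m)` of
`x ↦ 4 √(1 - x²) (1 + m x)`. -/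
lemma value_eq {m : ℝ} (hm : 1 ≤ m) {x y : ℝ} (hx : x = (√(1 + 8 * m ^ 2) - 1) / (4 * m))
    (hy0 : 0 ≤ y) (hy : y ^ 2 = 1 - x ^ 2) :
    √(8 * m ^ 2 - 2 + 2 * √(1 + 8 * m ^ 2)) * (√(1 + 8 * m ^ 2) + 3) / (4 * m) =
      4 * y * (1 + m * x) := by
  set r := √(1 + 8 * m ^ 2)
  have hr : r ^ 2 = 1 + 8 * m ^ 2 := Real.sq_sqrt (by positivity)
  have hx' : 4 * m * x = r - 1 := by rw [hx]; field_simp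
  have h1 : √(8 * m ^ 2 - 2 + 2 * r) = 4 * m * y := by
    rw [show 8 * m ^ 2 - 2 + 2 * r = (4 * m * y) ^ 2 by nlinarith]
    exact Real.sqrt_sq (by positivity)
  rw [h1, show r + 3 = 4 * (1 + m * x) by linarith]
  field_simp

/-- The equation of the critical point. -/
lemma half_le_and_critical {m z : ℝ} (hm : 1 ≤ m) (hz : z = (√(1 + 8 * m ^ 2) - 1) / (4 * m)) :
    1 / 2 ≤ z ∧ 2 * m * z ^ 2 + z = m := by
  set r := √(1 + 8 * m ^ 2)
  have hr : r ^ 2 = 1 + 8 * m ^ 2 := Real.sq_sqrt (by positivity)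
  have hzr : 4 * m * z = r - 1 := by rw [hz]; field_simp
  constructor
  · have : 2 * m + 1 ≤ r := Real.le_sqrt_of_sq_le (by nlinarith)
    rw [hz, le_div_iff₀ (by positivity)]; linarith
  · have h1 : (4 * m * z + 1) ^ 2 = 1 + 8 * m ^ 2 := by rw [hzr, ← hr]; ring
    have h2 : 8 * m * (2 * m * z ^ 2 + z) = 8 * m * m := by linarith
    exact mul_left_cancel₀ (by positivity) h2

/-- `2 m √(1 - s²) + √(8 + 8 s)` is the length of the path that runs `m` times along the base and
once along each leg of an isosceles triangle inscribed in the unit circle, the base being at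
distance `s` from the centre. -/
lemma length_le_value {m s b : ℝ} (hm : 1 ≤ m) (hs0 : 0 ≤ s) (hb : 0 ≤ b)
    (hsb : b ^ 2 + s ^ 2 = 1) :
    m * (2 * b) + √(8 + 8 * s) ≤
      √(8 * m ^ 2 - 2 + 2 * √(1 + 8 * m ^ 2)) * (√(1 + 8 * m ^ 2) + 3) / (4 * m) := by
  set r := √(1 + 8 * m ^ 2)
  obtain ⟨z, hz⟩ : ∃ z, z = (r - 1) / (4 * m) := ⟨_, rfl⟩
  obtain ⟨hz1, hcrit⟩ := half_le_and_critical hm hz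
  have hz2 : z ^ 2 ≤ 1 := by nlinarith
  rw [value_eq hm (x := z) (y := √(1 - z ^ 2)) hz (Real.sqrt_nonneg _)
    (Real.sq_sqrt (by linarith))]
  -- the half-angle `x` of the apex
  have hs1 : s ≤ 1 := by nlinarith
  set x := √((1 - s) / 2) with hx
  set y := √((1 + s) / 2) with hy
  have hx0 : 0 ≤ x := Real.sqrt_nonneg _
  have hy0 : 0 ≤ y := Real.sqrt_nonneg _
  have hx2 : x ^ 2 = (1 - s) / 2 := Real.sq_sqrt (by linarith)
  have hy2 : y ^ 2 = (1 + s) / 2 := Real.sq_sqrt (by linarith)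
  have hbxy : b = 2 * x * y := by
    rw [← abs_of_nonneg hb, ← abs_of_nonneg (by positivity : 0 ≤ 2 * x * y), ← sq_eq_sq_iff_abs_eq_abs]
    rw [mul_pow, mul_pow, hx2, hy2]; linarith
  have hleg : √(8 + 8 * s) = 4 * y := by
    rw [show 8 + 8 * s = (4 * y) ^ 2 by rw [mul_pow, hy2]; ring]
    exact Real.sqrt_sq (by positivity)
  rw [hbxy, hleg, show m * (2 * (2 * x * y)) + 4 * y = 4 * y * (1 + m * x) by ring]
  have hle : y * (1 + m * x) ≤ √(1 - z ^ 2) * (1 + m * z) := by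
    refine abs_le_of_sq_le_sq' ?_ (by positivity) |>.2
    rw [mul_pow, mul_pow, Real.sq_sqrt (by linarith), Real.sq_sqrt (by linarith), show (1 + s) / 2 = 1 - x ^ 2 by linarith]
    -- the difference has the double zero `x = z`
    have : (1 - z ^ 2) * (1 + m * z) ^ 2 - (1 - x ^ 2) * (1 + m * x) ^ 2
        = (x - z) ^ 2 * (m ^ 2 * x ^ 2 + (2 * m + 2 * m ^ 2 * z) * x + (1 + 3 * m * z + m ^ 2 * z ^ 2)) := by
      linear_combination (-(z - x) * 2 * (1 + m * z) + (x - z) ^ 2 * m) * hcrit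
    have : 0 ≤ (x - z) ^ 2 * (m ^ 2 * x ^ 2 + (2 * m + 2 * m ^ 2 * z) * x + (1 + 3 * m * z + m ^ 2 * z ^ 2)) := by
      positivity
    linarith
  linarith

/-! ### Coordinates adapted to a side -/

/-- The coordinate of `z` in the direction of the unit vector `e`, the origin being at `o`. -/
def along (o e z : EuclideanSpace ℝ (Fin 2)) : ℝ := e 0 * (z 0 - o 0) + e 1 * (z 1 - o 1)

/-- The coordinate of `z` in the direction of `e` rotated by a right angle, the origin being
at `o`. -/
def across (o e z : EuclideanSpace ℝ (Fin 2)) : ℝ := e 0 * (z 1 - o 1) - e 1 * (z 0 - o 0)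

section Frame

variable {o e : EuclideanSpace ℝ (Fin 2)}

lemma dist_sq_eq_along_across (he : e 0 ^ 2 + e 1 ^ 2 = 1) (z w : EuclideanSpace ℝ (Fin 2)) :
    dist z w ^ 2 = (along o e z - along o e w) ^ 2 + (across o e z - across o e w) ^ 2 := by
  have h : dist z w ^ 2 = (e 0 ^ 2 + e 1 ^ 2) * ((z 0 - w 0) ^ 2 + (z 1 - w 1) ^ 2) := by
    rw [EuclideanSpace.dist_sq_eq, he, Fin.sum_univ_two, Real.dist_eq, Real.dist_eq, sq_abs,
      sq_abs, one_mul]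
  rw [h, along, along, across, across]
  ring

lemma along_sq_add_across_sq_le (he : e 0 ^ 2 + e 1 ^ 2 = 1) {z : EuclideanSpace ℝ (Fin 2)}
    (hz : z ∈ Metric.closedBall o 1) : along o e z ^ 2 + across o e z ^ 2 ≤ 1 := by
  have h := dist_sq_eq_along_across (o := o) he z o
  have h0 : along o e o = 0 ∧ across o e o = 0 := by simp [along, across]
  rw [h0.1, h0.2, sub_zero, sub_zero] at h
  rw [← h]
  exact pow_le_one₀ dist_nonneg (Metric.mem_closedBall.1 hz)

lemma along_lineMap (z w : EuclideanSpace ℝ (Fin 2)) (t : ℝ) :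
    along o e (AffineMap.lineMap z w t) = along o e z + t * (along o e w - along o e z) := by
  simp only [along, AffineMap.lineMap_apply_module', PiLp.add_apply, PiLp.smul_apply,
    PiLp.sub_apply, smul_eq_mul]
  ring

lemma across_lineMap (z w : EuclideanSpace ℝ (Fin 2)) (t : ℝ) :
    across o e (AffineMap.lineMap z w t) = across o e z + t * (across o e w - across o e z) := by
  simp only [across, AffineMap.lineMap_apply_module', PiLp.add_apply, PiLp.smul_apply,
    PiLp.sub_apply, smul_eq_mul]
  ring

/-- There are coordinates in which a nondegenerate segment `XY` is horizontal. -/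
lemma exists_frame (o : EuclideanSpace ℝ (Fin 2)) {X Y : EuclideanSpace ℝ (Fin 2)} (hXY : X ≠ Y) :
    ∃ e : EuclideanSpace ℝ (Fin 2), e 0 ^ 2 + e 1 ^ 2 = 1 ∧
      along o e Y - along o e X = dist X Y ∧ across o e X = across o e Y := by
  have hd : 0 < dist X Y := dist_pos.2 hXY
  have hsq : dist X Y ^ 2 = (X 0 - Y 0) ^ 2 + (X 1 - Y 1) ^ 2 := by
    rw [EuclideanSpace.dist_sq_eq, Fin.sum_univ_two, Real.dist_eq, Real.dist_eq, sq_abs, sq_abs]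
  refine ⟨!₂[(Y 0 - X 0) / dist X Y, (Y 1 - X 1) / dist X Y], ?_, ?_, ?_⟩
  · simp only [Matrix.cons_val_zero, Matrix.cons_val_one]
    field_simp
    linarith
  · simp only [along, Matrix.cons_val_zero, Matrix.cons_val_one]
    field_simp
    linarith
  · simp only [across, Matrix.cons_val_zero, Matrix.cons_val_one]
    field_simp
    ring

/-- A side that crosses the strip around the horizontal side `XY` without meeting `XY` is short. -/
lemma dist_le_of_isSteep {s b : ℝ} (hs0 : 0 ≤ s) (hs : s ≤ 1 / 2) (hb : 0 < b)
    (hsb : b ^ 2 + s ^ 2 = 1) (he : e 0 ^ 2 + e 1 ^ 2 = 1) {X Y P Q : EuclideanSpace ℝ (Fin 2)}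
    (hX : X ∈ Metric.closedBall o 1) (hY : Y ∈ Metric.closedBall o 1)
    (hP : P ∈ Metric.closedBall o 1) (hQ : Q ∈ Metric.closedBall o 1)
    (hXY : along o e Y - along o e X = 2 * b) (hflat : across o e X = across o e Y)
    (hdisj : Disjoint (affineSegment ℝ P Q) (affineSegment ℝ X Y))
    (hst : IsSteep s (across o e P) (across o e Q)) : dist P Q ≤ 4 * s * b := by
  wlog h : s < across o e P ∧ across o e Q < -s generalizing P Q
  · rw [dist_comm]
    exact this hQ hP (by rwa [affineSegment_comm]) hst.symm (hst.resolve_left h).symm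
  refine abs_le_of_sq_le_sq' ?_ (by positivity) |>.2
  rw [dist_sq_eq_along_across (o := o) he]
  have hY' := along_sq_add_across_sq_le he hY
  rw [← hflat] at hY'
  refine sq_dist_le_of_cross_strip hs0 hs hb hsb (along_sq_add_across_sq_le he hX) hY' hXY
    (along_sq_add_across_sq_le he hP) (along_sq_add_across_sq_le he hQ) h.1 h.2 ?_
  intro t ht0 ht1 hheight ⟨hx, hy⟩
  -- the common point of the two segments
  set τ := (along o e P + t * (along o e Q - along o e P) - along o e X) / (2 * b) with hτ
  have hmem : AffineMap.lineMap X Y τ ∈ affineSegment ℝ X Y :=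
    ⟨τ, ⟨div_nonneg (by linarith) (by positivity), (div_le_one (by positivity)).2 (by linarith)⟩, rfl⟩
  refine Set.disjoint_left.1 hdisj ⟨t, ⟨ht0, ht1⟩, rfl⟩ ?_
  convert hmem using 1
  refine dist_eq_zero.1 (pow_eq_zero_iff two_ne_zero |>.1 ?_)
  rw [dist_sq_eq_along_across (o := o) he, along_lineMap, along_lineMap, across_lineMap,
    across_lineMap, hheight, hXY, ← hflat, hτ]
  field_simp
  ring

end Frame

/-! ### Two short sides of a simple polygon -/

/-- Around a closed chain of odd length, some two neighbouring values of a real function do not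
have opposite signs. -/
lemma exists_mul_finRotate_nonneg {n : ℕ} (hn : Odd n) (f : Fin n → ℝ) :
    ∃ i, 0 ≤ f i * f (finRotate n i) := by
  by_contra! h
  have h1 : ∏ i, -(f i * f (finRotate n i)) = -(∏ i, f i) ^ 2 := by
    rw [Finset.prod_neg, Finset.card_univ, Fintype.card_fin, hn.neg_one_pow,
      Finset.prod_mul_distrib, Equiv.prod_comp (finRotate n) f]
    ring
  have h2 : 0 < ∏ i, -(f i * f (finRotate n i)) := Finset.prod_pos fun i _ => by linarith [h i]
  linarith [sq_nonneg (∏ i, f i)]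

lemma finRotate_ne_self {n : ℕ} (hn : 2 ≤ n) (i : Fin n) : finRotate n i ≠ i := by
  obtain ⟨k, rfl⟩ : ∃ k, n = k + 2 := ⟨n - 2, by omega⟩
  rw [finRotate_apply]
  simp

/-- In a simple polygon with an odd number of vertices in the unit disk, whose longest side has the
length `2 b` of the chords at distance `s ≤ 1 / 2` from the centre, some two sides are together no
longer than the legs of the isosceles triangle inscribed in the circle over such a chord. -/
lemma exists_two_sides {o : EuclideanSpace ℝ (Fin 2)} {n : ℕ} (hn : 3 ≤ n) (hodd : Odd n)
    {A : Polygon (EuclideanSpace ℝ (Fin 2)) n} (hA : ∀ i, A i ∈ Metric.closedBall o 1)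
    (hsimple : A.IsSimple) {s b : ℝ} (hs0 : 0 ≤ s) (hs : s ≤ 1 / 2) (hb : 0 < b)
    (hsb : b ^ 2 + s ^ 2 = 1) {k : Fin n} (hk : dist (A k) (A (finRotate n k)) = 2 * b)
    (hmax : ∀ i, dist (A i) (A (finRotate n i)) ≤ 2 * b) :
    ∃ i j, i ≠ j ∧
      dist (A i) (A (finRotate n i)) + dist (A j) (A (finRotate n j)) ≤ √(8 + 8 * s) := by
  obtain ⟨e, he, hlen, hflat⟩ := exists_frame o (X := A k) (Y := A (finRotate n k))
    (dist_pos.1 (by rw [hk]; positivity))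
  rw [hk] at hlen
  have hrot := finRotate_ne_self (show 2 ≤ n by omega)
  have hunit := fun i => along_sq_add_across_sq_le he (hA i)
  by_cases hsteep : ∃ i, IsSteep s (across o e (A i)) (across o e (A (finRotate n i)))
  · obtain ⟨i, hi⟩ := hsteep
    refine ⟨i, finRotate n i, (hrot i).symm, ?_⟩
    -- the ends of the horizontal side lie in the strip, so it has none of them in common with `i`
    have hstrip : across o e (A k) ^ 2 ≤ s ^ 2 := by
      have h1 := hunit k
      have h2 := hunit (finRotate n k)
      rw [← hflat] at h2
      nlinarith [sq_nonneg (along o e (A k) + along o e (A (finRotate n k)))]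
    obtain ⟨hst1, hst2⟩ := abs_le_of_sq_le_sq' hstrip hs0
    have hne : ∀ j, across o e (A j) = across o e (A k) → i ≠ j ∧ finRotate n i ≠ j := by
      intro j hj
      constructor
      · rintro rfl
        rcases hi with h | h <;> linarith [h.1, h.2]
      · rintro rfl
        rcases hi with h | h <;> linarith [h.1, h.2]
    have hdisj : Disjoint (A.edgeSet ℝ i) (A.edgeSet ℝ k) :=
      hsimple.2.2 i k (hne k rfl).1 (hne k rfl).2.symm (hne _ hflat.symm).1
    have h1 : dist (A i) (A (finRotate n i)) ≤ 4 * s * b :=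
      dist_le_of_isSteep hs0 hs hb hsb he (hA _) (hA _) (hA _) (hA _) hlen hflat hdisj hi
    refine Real.le_sqrt_of_sq_le ?_
    have h2 := hmax (finRotate n i)
    have h3 : (dist (A i) (A (finRotate n i)) +
        dist (A (finRotate n i)) (A (finRotate n (finRotate n i)))) ^ 2 ≤
        (2 * b * (1 + 2 * s)) ^ 2 :=
      pow_le_pow_left₀ (by positivity) (by linarith) 2
    have h4 : (2 * b * (1 + 2 * s)) ^ 2 = 8 + 8 * s - 4 * ((1 - 2 * s) ^ 2 * (1 + s) ^ 2) := by
      rw [mul_pow, mul_pow, show b ^ 2 = 1 - s ^ 2 by linarith]; ring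
    have h5 : 0 ≤ (1 - 2 * s) ^ 2 * (1 + s) ^ 2 := by positivity
    linarith
  · push Not at hsteep
    -- sides `UV`, `VW` of total squared length at most `4 + 4 s`
    have hadj : ∀ U V W : EuclideanSpace ℝ (Fin 2),
        dist U V ^ 2 + dist V W ^ 2 ≤ 4 + 4 * s → dist U V + dist V W ≤ √(8 + 8 * s) := by
      intro U V W h
      exact Real.le_sqrt_of_sq_le (by linarith [sq_nonneg (dist U V - dist V W)])
    obtain ⟨i, hi⟩ := exists_mul_finRotate_nonneg hodd fun i => along o e (A i)
    rcases le_total |along o e (A (finRotate n i))| |along o e (A i)| with h | h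
    · refine ⟨i, finRotate n i, (hrot i).symm, hadj _ _ _ ?_⟩
      rw [dist_sq_eq_along_across (o := o) he, dist_sq_eq_along_across (o := o) he]
      exact ((isSteep_or_sq_add_sq_le hs0 hs (hunit _) (hunit _) (hunit _) hi h).resolve_left
        (hsteep _)).resolve_left (hsteep _)
    · obtain ⟨j, rfl⟩ := (finRotate n).surjective i
      refine ⟨finRotate n j, j, hrot j, ?_⟩
      rw [dist_comm (A (finRotate n j)), dist_comm (A j)]
      refine hadj _ _ _ ?_
      rw [dist_sq_eq_along_across (o := o) he, dist_sq_eq_along_across (o := o) he]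
      rw [mul_comm] at hi
      exact ((isSteep_or_sq_add_sq_le hs0 hs (hunit _) (hunit _) (hunit _) hi h).resolve_left
        fun h => hsteep _ h.symm).resolve_left fun h => hsteep _ h.symm

/-- Two sides bounded together by `h` and the remaining ones bounded by `c` each. -/
lemma perimeter_le_of_two_sides {n : ℕ} (A : Polygon (EuclideanSpace ℝ (Fin 2)) n) {c h : ℝ}
    (hc : ∀ i, dist (A i) (A (finRotate n i)) ≤ c) {i j : Fin n} (hij : i ≠ j)
    (hsum : dist (A i) (A (finRotate n i)) + dist (A j) (A (finRotate n j)) ≤ h) :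
    A.perimeter ≤ ((n : ℝ) - 2) * c + h := by
  have h1 : ∑ k ∈ {i, j}, (c - dist (A k) (A (finRotate n k))) ≤
      ∑ k, (c - dist (A k) (A (finRotate n k))) :=
    Finset.sum_le_sum_of_subset_of_nonneg (Finset.subset_univ _)
      fun k _ _ => sub_nonneg.2 (hc k)
  rw [Finset.sum_pair hij, Finset.sum_sub_distrib, Finset.sum_const, Finset.card_univ,
    Fintype.card_fin, nsmul_eq_mul] at h1
  rw [Polygon.perimeter]
  linarith

lemma perimeter_le {o : EuclideanSpace ℝ (Fin 2)} {n : ℕ} (hn : 3 ≤ n) (hodd : Odd n)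
    {A : Polygon (EuclideanSpace ℝ (Fin 2)) n} (hA : ∀ i, A i ∈ Metric.closedBall o 1)
    (hsimple : A.IsSimple) :
    A.perimeter ≤
      √(8 * ((n : ℝ) - 2) ^ 2 - 2 + 2 * √(1 + 8 * ((n : ℝ) - 2) ^ 2)) *
        (√(1 + 8 * ((n : ℝ) - 2) ^ 2) + 3) / (4 * ((n : ℝ) - 2)) := by
  have hm : (1 : ℝ) ≤ (n : ℝ) - 2 := by
    have : (3 : ℝ) ≤ n := by exact_mod_cast hn
    linarith
  have : Nonempty (Fin n) := ⟨⟨0, by omega⟩⟩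
  have hrot := finRotate_ne_self (show 2 ≤ n by omega)
  obtain ⟨k, hk⟩ := Finite.exists_max fun i => dist (A i) (A (finRotate n i))
  obtain ⟨b, hbk⟩ : ∃ b, dist (A k) (A (finRotate n k)) = 2 * b :=
    ⟨dist (A k) (A (finRotate n k)) / 2, by ring⟩
  have hmax : ∀ i, dist (A i) (A (finRotate n i)) ≤ 2 * b := fun i => (hk i).trans hbk.le
  have hb : 0 < b := by
    have : 0 < dist (A k) (A (finRotate n k)) :=
      dist_pos.2 fun h => hrot k (hsimple.1 h).symm
    linarith
  by_cases hlong : b ^ 2 ≤ 3 / 4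
  · -- all sides are at most as long as those of the inscribed equilateral triangle
    have hb' : b ≤ √(3 / 4) := Real.le_sqrt_of_sq_le hlong
    have h0 : (√(3 / 4) : ℝ) ^ 2 = 3 / 4 := Real.sq_sqrt (by norm_num)
    refine le_trans (perimeter_le_of_two_sides A (c := 2 * √(3 / 4)) (h := √(8 + 8 * (1 / 2)))
      (fun i => (hmax i).trans (by linarith)) (hrot k) ?_)
      (length_le_value hm (s := 1 / 2) (by norm_num) (Real.sqrt_nonneg _) (by rw [h0]; norm_num))
    refine Real.le_sqrt_of_sq_le ?_
    have h1 := hmax k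
    have h2 := hmax (finRotate n k)
    calc _ ≤ (4 * b) ^ 2 := pow_le_pow_left₀ (by positivity) (by linarith) 2
      _ ≤ _ := by rw [mul_pow]; linarith
  · push Not at hlong
    have hb1 : b ≤ 1 := by
      have := (dist_triangle_right (A k) (A (finRotate n k)) o).trans
        (add_le_add (Metric.mem_closedBall.1 (hA k)) (Metric.mem_closedBall.1 (hA _)))
      linarith
    have hs : √(1 - b ^ 2) ^ 2 = 1 - b ^ 2 := Real.sq_sqrt (by nlinarith)
    have hsb : b ^ 2 + √(1 - b ^ 2) ^ 2 = 1 := by rw [hs]; ring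
    obtain ⟨i, j, hij, hle⟩ := exists_two_sides hn hodd hA hsimple (Real.sqrt_nonneg (1 - b ^ 2))
      (Real.sqrt_le_iff.2 ⟨by norm_num, by linarith⟩) hb hsb hbk hmax
    exact (perimeter_le_of_two_sides A hmax hij hle).trans
      (length_le_value hm (Real.sqrt_nonneg _) hb.le hsb)

/-! ### Zigzag polygons -/

lemma val_finRotate {n : ℕ} (i : Fin n) :
    ((finRotate n i : Fin n) : ℕ) = if (i : ℕ) + 1 < n then (i : ℕ) + 1 else 0 := by
  obtain ⟨k, rfl⟩ : ∃ k, n = k + 1 := ⟨n - 1, by have := i.2; omega⟩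
  rcases eq_or_ne i (Fin.last k) with rfl | h
  · simp
  · have h' : (i : ℕ) < k := Fin.val_lt_last h
    rw [coe_finRotate_of_ne_last h, if_pos (by omega)]

lemma mem_affineSegment_eq_left_or_eq_right {E : Type*} [AddCommGroup E] [Module ℝ E]
    (f : E →ₗ[ℝ] ℝ) {a b z : E} {γ : ℝ} (hz : z ∈ affineSegment ℝ a b) (ha : f a ≤ γ)
    (hb : f b ≤ γ) (hzγ : f z = γ) (hab : ¬(f a = γ ∧ f b = γ)) :
    (z = a ∧ f a = γ) ∨ (z = b ∧ f b = γ) := by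
  obtain ⟨t, ⟨ht0, ht1⟩, rfl⟩ := hz
  have h : f (AffineMap.lineMap a b t) = (1 - t) * f a + t * f b := by
    rw [AffineMap.lineMap_apply_module, map_add, map_smul, map_smul, smul_eq_mul, smul_eq_mul]
  rw [h] at hzγ
  have h1 : 0 ≤ (1 - t) * (γ - f a) := mul_nonneg (by linarith) (by linarith)
  have h2 : 0 ≤ t * (γ - f b) := mul_nonneg ht0 (by linarith)
  have h1' : (1 - t) * (γ - f a) = 0 := by linarith
  have h2' : t * (γ - f b) = 0 := by linarith
  rcases mul_eq_zero.1 h1' with h3 | h3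
  · obtain rfl : t = 1 := by linarith
    exact Or.inr ⟨by simp, by linarith⟩
  · rcases mul_eq_zero.1 h2' with h4 | h4
    · subst h4
      exact Or.inl ⟨by simp, by linarith⟩
    · exact absurd ⟨by linarith, by linarith⟩ hab

lemma le_of_mem_affineSegment {E : Type*} [AddCommGroup E] [Module ℝ E]
    (f : E →ₗ[ℝ] ℝ) {a b z : E} (hz : z ∈ affineSegment ℝ a b) (hab : f b ≤ f a) :
    f b ≤ f z ∧ f z ≤ f a := by
  obtain ⟨t, ⟨ht0, ht1⟩, rfl⟩ := hz
  have h : f (AffineMap.lineMap a b t) = (1 - t) * f a + t * f b := by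
    rw [AffineMap.lineMap_apply_module, map_add, map_smul, map_smul, smul_eq_mul, smul_eq_mul]
  rw [h]
  constructor <;> nlinarith

/-- A chain along which the linear function `f` decreases is simple when closed by a side of which
the remaining vertices lie strictly on one side. -/
lemma isSimple_of_strictAnti {n : ℕ} (hn : 3 ≤ n) (p : ℕ → EuclideanSpace ℝ (Fin 2))
    (f g : EuclideanSpace ℝ (Fin 2) →ₗ[ℝ] ℝ) {γ : ℝ}
    (hf : ∀ i j, i < j → j < n → f (p j) < f (p i))
    (hfirst : g (p 0) = γ) (hlast : g (p (n - 1)) = γ)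
    (hg : ∀ i, 0 < i → i + 1 < n → g (p i) < γ) :
    Polygon.IsSimple (n := n) ⟨fun i => p i⟩ := by
  -- the `i`-th side for `i + 1 < n`, and the closing one
  have hside : ∀ i : Fin n, (i : ℕ) + 1 < n →
      Polygon.edgeSet ℝ (⟨fun i => p i⟩ : Polygon (EuclideanSpace ℝ (Fin 2)) n) i =
        affineSegment ℝ (p i) (p (i + 1)) := by
    intro i hi
    simp only [Polygon.edgeSet, val_finRotate, if_pos hi]
  have hclose : ∀ i : Fin n, (i : ℕ) + 1 = n →
      Polygon.edgeSet ℝ (⟨fun i => p i⟩ : Polygon (EuclideanSpace ℝ (Fin 2)) n) i =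
        affineSegment ℝ (p (n - 1)) (p 0) := by
    intro i hi
    simp only [Polygon.edgeSet, val_finRotate, if_neg hi.not_lt]
    rw [show (i : ℕ) = n - 1 by omega]
  have hgle : ∀ i, i < n → g (p i) ≤ γ := by
    intro i hi
    rcases Nat.eq_zero_or_pos i with rfl | h0
    · exact hfirst.le
    · rcases Nat.lt_or_ge (i + 1) n with h | h
      · exact (hg i h0 h).le
      · rw [show i = n - 1 by omega]; exact hlast.le
  have hgeq : ∀ i, i < n → g (p i) = γ → i = 0 ∨ i + 1 = n := by
    intro i hi h
    by_contra hc
    exact (hg i (by omega) (by omega)).ne h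
  -- the closing side meets a side of the chain only in one of its own ends
  have hmeet : ∀ i z, i + 1 < n → z ∈ affineSegment ℝ (p i) (p (i + 1)) →
      z ∈ affineSegment ℝ (p (n - 1)) (p 0) → (z = p i ∧ i = 0) ∨ (z = p (i + 1) ∧ i + 2 = n) := by
    intro i z hi hz hzc
    have hzγ : g z = γ := by
      have h := le_of_mem_affineSegment g hzc (hfirst.trans hlast.symm).le
      rw [hfirst, hlast] at h
      exact h.2.antisymm h.1
    rcases mem_affineSegment_eq_left_or_eq_right g hz (hgle _ (by omega)) (hgle _ hi) hzγ
      (fun h => by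
        have h1 := hgeq _ (by omega) h.1
        have h2 := hgeq _ hi h.2
        omega) with ⟨h1, h2⟩ | ⟨h1, h2⟩
    · exact Or.inl ⟨h1, by have := hgeq _ (by omega) h2; omega⟩
    · exact Or.inr ⟨h1, by have := hgeq _ hi h2; omega⟩
  have hrange : ∀ i z, i + 1 < n → z ∈ affineSegment ℝ (p i) (p (i + 1)) →
      f (p (i + 1)) ≤ f z ∧ f z ≤ f (p i) := fun i z hi hz =>
    le_of_mem_affineSegment f hz (hf i (i + 1) (by omega) hi).le
  have hinj : ∀ i j, i < j → j < n → p i ≠ p j := fun i j hij hj h =>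
    (hf i j hij hj).ne (by rw [h])
  refine ⟨?_, ?_, ?_⟩
  · intro i j hij
    rcases lt_trichotomy (i : ℕ) j with h | h | h
    · exact absurd hij (hinj _ _ h j.2)
    · exact Fin.ext h
    · exact absurd hij.symm (hinj _ _ h i.2)
  · intro i
    refine Set.Subset.antisymm ?_ ?_
    · rintro z ⟨hz1, hz2⟩
      rw [Set.mem_singleton_iff]
      change z = p (finRotate n i : Fin n)
      have hv := val_finRotate i
      rcases Nat.lt_or_ge ((i : ℕ) + 1) n with hi | hi
      · rw [if_pos hi] at hv
        rw [hside i hi] at hz1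
        rw [hv]
        rcases Nat.lt_or_ge ((i : ℕ) + 2) n with hi2 | hi2
        · rw [hside _ (by omega), hv] at hz2
          have h1 := (hrange _ _ hi hz1).1
          have h2 := (hrange _ _ hi2 hz2).2
          have h3 := hf i (i + 1) (by omega) hi
          -- the common point has the height of the common vertex
          rcases mem_affineSegment_eq_left_or_eq_right (-f) (γ := -f (p (i + 1))) hz1
            (by simpa using h3.le) le_rfl (by simpa using h2.antisymm h1)
            (fun h => h3.ne (by simpa using h.1.symm)) with h | h
          · exact absurd h.2 (by simpa using h3.ne')
          · exact h.1
        · rw [hclose _ (by omega)] at hz2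
          rcases hmeet _ _ hi hz1 hz2 with h | h
          · omega
          · exact h.1
      · rw [if_neg (by omega)] at hv
        rw [hclose i (by omega)] at hz1
        rw [hside _ (by omega), hv] at hz2
        rw [hv]
        rcases hmeet _ _ (by omega) hz2 hz1 with h | h
        · exact h.1
        · omega
    · rintro z rfl
      exact ⟨right_mem_affineSegment ℝ _ _, left_mem_affineSegment ℝ _ _⟩
  · intro i j hij hj hi
    have hij' : (i : ℕ) ≠ j := fun h => hij (Fin.ext h)
    wlog hlt : (i : ℕ) < j generalizing i j
    · exact (this j i hij.symm hi hj hij'.symm (by omega)).symm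
    have hj' : (j : ℕ) ≠ i + 1 := fun h => hj (Fin.ext (by
      rw [val_finRotate, if_pos (by omega), h]))
    rw [Set.disjoint_left]
    intro z hz1 hz2
    rw [hside i (by omega)] at hz1
    rcases Nat.lt_or_ge ((j : ℕ) + 1) n with hjn | hjn
    · rw [hside j hjn] at hz2
      have h1 := (hrange _ _ (by omega) hz1).1
      have h2 := (hrange _ _ hjn hz2).2
      have h3 := hf (i + 1) j (by omega) (by omega)
      linarith
    · rw [hclose j (by omega)] at hz2
      rcases hmeet _ _ (by omega) hz1 hz2 with h | h
      · exact hi (Fin.ext (by rw [val_finRotate, if_neg (by omega), h.2]))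
      · omega

/-- The vertices of a zigzag inside the isosceles triangle with apex `o + (0, 1)` and base vertices
`o + (±w, -s)`. The first vertex is the apex; the following ones lie alternately near the left and
the right base vertex, at heights that decrease by steps proportional to `ε`, and the last one is
the right base vertex. -/
noncomputable def zigzag (o : EuclideanSpace ℝ (Fin 2)) (n : ℕ) (w s ε : ℝ) (i : ℕ) :
    EuclideanSpace ℝ (Fin 2) :=
  if i = 0 then o + !₂[0, 1]
  else o + !₂[(-1) ^ i * w * (1 - 2 * (ε * ((n : ℝ) - 1 - i))), -s + ε * ((n : ℝ) - 1 - i) * (1 + s)]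

lemma zigzag_isSimple (o : EuclideanSpace ℝ (Fin 2)) {n : ℕ} (hn : 3 ≤ n) (hodd : Odd n)
    {w s ε : ℝ} (hw : 0 < w) (hs : -1 < s) (hε : 0 < ε) (hεn : ε * n ≤ 1 / 2) :
    Polygon.IsSimple (n := n) ⟨fun i => zigzag o n w s ε i⟩ := by
  have hδ : ∀ i : ℕ, ε * ((n : ℝ) - 1 - i) ≤ 1 / 2 := fun i => by
    have : 0 ≤ ε * (1 + i) := by positivity
    linarith
  -- the height, and a function that is constant on the right leg
  refine isSimple_of_strictAnti hn _ (EuclideanSpace.projₗ 1)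
    ((1 + s) • EuclideanSpace.projₗ 0 + w • EuclideanSpace.projₗ 1)
    (γ := (1 + s) * o 0 + w * (o 1 + 1)) ?_ ?_ ?_ ?_
  · intro i j hij hj
    have hj0 : j ≠ 0 := by omega
    simp only [PiLp.projₗ_apply, zigzag, if_neg hj0]
    split_ifs with hi
    · simp only [PiLp.add_apply, Matrix.cons_val_one, Matrix.cons_val_fin_one]
      nlinarith [hδ j]
    · have : ε * ((n : ℝ) - 1 - j) < ε * ((n : ℝ) - 1 - i) := by
        have : (i : ℝ) < j := by exact_mod_cast hij
        exact mul_lt_mul_of_pos_left (by linarith) hε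
      simp only [PiLp.add_apply, Matrix.cons_val_one, Matrix.cons_val_fin_one]
      nlinarith
  · simp [zigzag]
  · have h0 : n - 1 ≠ 0 := by omega
    have h1 : ((n - 1 : ℕ) : ℝ) = n - 1 := by push_cast [show 1 ≤ n by omega]; ring
    have h2 : Even (n - 1) := hodd.tsub_odd odd_one
    simp [zigzag, h0, h1, h2.neg_one_pow]
    ring
  · intro i hi0 hi
    have hpos : 0 < ε * ((n : ℝ) - 1 - i) := by
      have : (i : ℝ) + 1 < n := by exact_mod_cast hi
      exact mul_pos hε (by linarith)
    simp only [zigzag, if_neg hi0.ne', LinearMap.add_apply, LinearMap.smul_apply,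
      PiLp.projₗ_apply, PiLp.add_apply, Matrix.cons_val_zero, Matrix.cons_val_one,
      Matrix.cons_val_fin_one, smul_eq_mul]
    set δ := ε * ((n : ℝ) - 1 - i)
    have h1 : (1 + s) * ((-1) ^ i * w * (1 - 2 * δ)) ≤ (1 + s) * (w * (1 - 2 * δ)) := by
      refine mul_le_mul_of_nonneg_left ?_ (by linarith)
      refine mul_le_mul_of_nonneg_right ?_ (by linarith [hδ i])
      rcases neg_one_pow_eq_or ℝ i with h | h <;> rw [h] <;> linarith
    have h2 : 0 < (1 + s) * w * δ := mul_pos (mul_pos (by linarith) hw) hpos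
    linarith

lemma zigzag_mem_closedBall (o : EuclideanSpace ℝ (Fin 2)) {n : ℕ}
    {w s ε : ℝ} (hs : -1 < s) (hws : w ^ 2 + s ^ 2 = 1) (hε : 0 < ε)
    (hεn : ε * n ≤ 1 / 2) {i : ℕ} (hi : i < n) : zigzag o n w s ε i ∈ Metric.closedBall o 1 := by
  rw [Metric.mem_closedBall]
  refine abs_le_of_sq_le_sq' ?_ zero_le_one |>.2
  rw [EuclideanSpace.dist_sq_eq, Fin.sum_univ_two, Real.dist_eq, Real.dist_eq, sq_abs, sq_abs]
  unfold zigzag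
  split_ifs with h0
  · simp
  · simp only [PiLp.add_apply, Matrix.cons_val_zero, Matrix.cons_val_one,
      Matrix.cons_val_fin_one, add_sub_cancel_left]
    have h1 : 0 ≤ ε * ((n : ℝ) - 1 - i) := by
      have : (i : ℝ) + 1 ≤ n := by exact_mod_cast hi
      exact mul_nonneg hε.le (by linarith)
    have h2 : ε * ((n : ℝ) - 1 - i) ≤ 1 / 2 := by
      have : 0 ≤ ε * (1 + i) := by positivity
      linarith
    set δ := ε * ((n : ℝ) - 1 - i)
    have h3 : ((-1 : ℝ) ^ i * w * (1 - 2 * δ)) ^ 2 = w ^ 2 * (1 - 2 * δ) ^ 2 := by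
      rw [mul_pow, mul_pow, ← pow_mul, mul_comm i 2, pow_mul]; norm_num
    have h4 : w ^ 2 * (1 - 2 * δ) ^ 2 ≤ w ^ 2 * (1 - δ) ^ 2 :=
      mul_le_mul_of_nonneg_left (pow_le_pow_left₀ (by linarith) (by linarith) 2) (sq_nonneg w)
    have h5 : 0 ≤ (1 + s) * (δ * (1 - δ)) :=
      mul_nonneg (by linarith) (mul_nonneg h1 (by linarith))
    have h6 : w ^ 2 * (1 - δ) ^ 2 + (-s + δ * (1 + s)) ^ 2 + 2 * ((1 + s) * (δ * (1 - δ))) = 1 := by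
      rw [show w ^ 2 = 1 - s ^ 2 by linarith]; ring
    rw [h3]
    linarith

lemma continuous_zigzag (o : EuclideanSpace ℝ (Fin 2)) (n : ℕ) (w s : ℝ) (i : ℕ) :
    Continuous fun ε => zigzag o n w s ε i := by
  unfold zigzag
  split_ifs with h
  · fun_prop
  · refine continuous_const.add ((PiLp.continuous_toLp 2 _).comp (continuous_pi fun j => ?_))
    fin_cases j
    · simp only [Fin.zero_eta, Matrix.cons_val_zero]; fun_prop
    · simp only [Fin.mk_one, Matrix.cons_val_one, Matrix.cons_val_fin_one]; fun_prop

lemma dist_add_vec (o : EuclideanSpace ℝ (Fin 2)) (a b c d : ℝ) :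
    dist (o + !₂[a, b]) (o + !₂[c, d]) = √((a - c) ^ 2 + (b - d) ^ 2) := by
  rw [dist_add_left, EuclideanSpace.dist_eq, Fin.sum_univ_two]
  simp [Real.dist_eq]

/-- The flat zigzag runs `n - 2` times along the base of the triangle and once along each leg. -/
lemma perimeter_zigzag_zero (o : EuclideanSpace ℝ (Fin 2)) {n : ℕ} (hn : 3 ≤ n)
    {w s : ℝ} (hw : 0 < w) (hws : w ^ 2 + s ^ 2 = 1) :
    Polygon.perimeter (n := n) ⟨fun i => zigzag o n w s 0 i⟩ =
      ((n : ℝ) - 2) * (2 * w) + 2 * √(2 + 2 * s) := by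
  obtain ⟨k, rfl⟩ : ∃ k, n = k + 2 := ⟨n - 2, by omega⟩
  have hz : ∀ i : ℕ, i ≠ 0 → zigzag o (k + 2) w s 0 i = o + !₂[(-1) ^ i * w, -s] := by
    intro i hi
    simp [zigzag, hi]
  have hz0 : zigzag o (k + 2) w s 0 0 = o + !₂[0, 1] := by simp [zigzag]
  have hleg : ∀ i : ℕ, i ≠ 0 →
      dist (zigzag o (k + 2) w s 0 0) (zigzag o (k + 2) w s 0 i) = √(2 + 2 * s) := by
    intro i hi
    rw [hz0, hz i hi, dist_add_vec]
    congr 1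
    have : ((-1 : ℝ) ^ i * w) ^ 2 = w ^ 2 := by
      rw [mul_pow, ← pow_mul, mul_comm i 2, pow_mul]; norm_num
    linear_combination this + hws
  have hbase : ∀ i : ℕ, i ≠ 0 →
      dist (zigzag o (k + 2) w s 0 i) (zigzag o (k + 2) w s 0 (i + 1)) = 2 * w := by
    intro i hi
    rw [hz i hi, hz (i + 1) (by omega), dist_add_vec, ← Real.sqrt_sq (show 0 ≤ 2 * w by linarith)]
    congr 1
    have : ((-1 : ℝ) ^ i) ^ 2 = 1 := by rw [← pow_mul, mul_comm, pow_mul]; norm_num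
    rw [pow_succ]
    linear_combination 4 * w ^ 2 * this
  have hnext : ∀ i : Fin (k + 2), (i : ℕ) + 1 < k + 2 →
      ((finRotate (k + 2) i : Fin (k + 2)) : ℕ) = i + 1 := fun i hi => by
    rw [val_finRotate, if_pos hi]
  have hback : ((finRotate (k + 2) (Fin.last k).succ : Fin (k + 2)) : ℕ) = 0 := by
    rw [val_finRotate, if_neg (by simp)]
  have hmid : ∀ i : Fin k, dist (zigzag o (k + 2) w s 0 (i.castSucc.succ : Fin (k + 2)))
      (zigzag o (k + 2) w s 0 (finRotate (k + 2) i.castSucc.succ : Fin (k + 2))) = 2 * w := by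
    intro i
    rw [hnext _ (by simp), hbase _ (by simp)]
  rw [Polygon.perimeter, Fin.sum_univ_succ, Fin.sum_univ_castSucc]
  dsimp only
  rw [Finset.sum_congr rfl fun i _ => hmid i, hback, hnext 0 (by simp), Fin.val_zero,
    hleg _ (by simp), dist_comm, hleg _ (by simp)]
  rw [Finset.sum_const, Finset.card_univ, Fintype.card_fin, nsmul_eq_mul]
  push_cast
  ring

/-- The perimeters of the zigzags tend to that of the flat one. -/
lemma le_of_mem_upperBounds {o : EuclideanSpace ℝ (Fin 2)} {n : ℕ} (hn : 3 ≤ n) (hodd : Odd n)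
    {w s u : ℝ} (hw : 0 < w) (hs : -1 < s) (hws : w ^ 2 + s ^ 2 = 1)
    (hu : u ∈ upperBounds (simplePerimeters o n)) :
    ((n : ℝ) - 2) * (2 * w) + 2 * √(2 + 2 * s) ≤ u := by
  have hcont : Continuous fun ε =>
      Polygon.perimeter (n := n) ⟨fun i => zigzag o n w s ε i⟩ := by
    unfold Polygon.perimeter
    exact continuous_finsetSum _ fun i _ =>
      (continuous_zigzag o n w s _).dist (continuous_zigzag o n w s _)
  have htend := (hcont.tendsto 0).mono_left (nhdsWithin_le_nhds (s := Set.Ioi 0))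
  rw [perimeter_zigzag_zero o hn hw hws] at htend
  refine le_of_tendsto htend ?_
  have hn0 : (0 : ℝ) < n := by exact_mod_cast (by omega : 0 < n)
  filter_upwards [Ioo_mem_nhdsGT (show (0 : ℝ) < 1 / (2 * n) by positivity)] with ε hε
  have hεn : ε * n ≤ 1 / 2 := by
    have := hε.2.le
    rw [le_div_iff₀ (by positivity)] at this
    linarith
  exact hu ⟨⟨fun i => zigzag o n w s ε i⟩, fun i => zigzag_mem_closedBall o hs hws hε.1 hεn i.2,
    zigzag_isSimple o hn hodd hw hs hε.1 hεn, rfl⟩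

theorem theorem5 (o : EuclideanSpace ℝ (Fin 2)) (n : ℕ) (hn : 3 ≤ n) (hodd : Odd n) :
    IsLUB (simplePerimeters o n)
      (Real.sqrt (8 * ((n : ℝ) - 2) ^ 2 - 2 + 2 * Real.sqrt (1 + 8 * ((n : ℝ) - 2) ^ 2)) *
          (Real.sqrt (1 + 8 * ((n : ℝ) - 2) ^ 2) + 3) /
        (4 * ((n : ℝ) - 2))) := by
  refine ⟨?_, fun u hu => ?_⟩
  · rintro _ ⟨A, hA, hsimple, rfl⟩
    exact perimeter_le hn hodd hA hsimple
  · have hm : (1 : ℝ) ≤ (n : ℝ) - 2 := by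
      have : (3 : ℝ) ≤ n := by exact_mod_cast hn
      linarith
    set m : ℝ := (n : ℝ) - 2 with hmdef
    obtain ⟨z, hz⟩ : ∃ z, z = (√(1 + 8 * m ^ 2) - 1) / (4 * m) := ⟨_, rfl⟩
    obtain ⟨hz1, hcrit⟩ := half_le_and_critical hm hz
    have hz2 : z ^ 2 < 1 := by nlinarith
    obtain ⟨y, hy⟩ : ∃ y, y = √(1 - z ^ 2) := ⟨_, rfl⟩
    have hy0 : 0 < y := by rw [hy]; exact Real.sqrt_pos.2 (by linarith)
    have hy2 : y ^ 2 = 1 - z ^ 2 := by rw [hy]; exact Real.sq_sqrt (by linarith)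
    rw [value_eq hm hz hy0.le hy2]
    -- the triangle with half-angle `arcsin z` at the apex
    have h := le_of_mem_upperBounds hn hodd (w := 2 * z * y) (s := 1 - 2 * z ^ 2)
      (by positivity) (by linarith) (by rw [mul_pow, hy2]; ring) hu
    have hleg : √(2 + 2 * (1 - 2 * z ^ 2)) = 2 * y := by
      rw [show 2 + 2 * (1 - 2 * z ^ 2) = (2 * y) ^ 2 by rw [mul_pow, hy2]; ring]
      exact Real.sqrt_sq (by linarith)
    rw [hleg] at h
    linarith
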